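/- Let $R$ be a commutative ring and let $A$ be a commutative $R$-algebra of rank $n$, i.e. finitely generated, projective and locally free of constant rank $n$ as an $R$-module. For $a\in S\otimes_R A$ ($S$ a commutative $R$-algebra) let $P_a(X)\in S[X]$ be the characteristic polynomial of multiplication by $a$, and let $s_n$ be the norm law $a\mapsto\det_S(\text{multiplication by }a)$. A polynomial law from an $R$-module $M$ to an $R$-module $N$ is a family of maps $f_S\colon S\otimes_R M\to S\otimes_R N$, natural in the commutative $R$-algebra $S$; it is homogeneous of degree $d$ if $f_S(sx)=s^d f_S(x)$ always. A law between $R$-algebras is multiplicative if every $f_S$ preserves products and $1$. A linear map is regarded as a law by base change. For $m\ge 1$, an $m$-closure of $A$ is a commutative $R$-algebra $A^{(m)}$ with $R$-algebra homomorphisms $\alpha_1,\dots,\alpha_m\colon A\to A^{(m)}$ such that for all $R\to S$ and $a\in S\otimes_R A$ the polynomial $\prod_{i=1}^m (X-\alpha_{i,S}(a))$ divides $P_a(X)$ in $(S\otimes_R A^{(m)})[X]$, and which is universal among such data. For $n_1,\dots,n_t\ge 0$ with $\sum n_i=n$, Ferrand's algebra $A^{(n_1,\dots,n_t)}$ is a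 commutative $R$-algebra $C$ with multiplicative polynomial laws $\delta_i\colon A\to C$, homogeneous of degree $n_i$, such that $s_n=\prod_i\delta_i$, and which is universal among such data. Let $1\le m\le n$. Then: 1. An $m$-closure of $A$ exists. 2. If $B$ is a commutative $R$-algebra, $\beta_1,\dots,\beta_m\colon A\to B$ are $R$-algebra homomorphisms and $\beta\colon A\to B$ is a polynomial law, homogeneous of degree $n-m$, with $s_n=\beta\prod_i\beta_i$, then $\beta$ is multiplicative. 3. For every $m$-closure $(A^{(m)},\alpha_1,\dots,\alpha_m)$ there is a unique polynomial law $\alpha\colon A\to A^{(m)}$ with $s_n=\alpha\prod_i\alpha_i$; it is homogeneous of degree $n-m$ and multiplicative. With the laws $\alpha_1,\dots,\alpha_m,\alpha$, the algebra $A^{(m)}$ is Ferrand's algebra $A^{(1,\dots,1,n-m)}$ (with $m$ ones). It is even universal for factorizations as in 2, in which the law of degree $n-m$ is not assumed multiplicative: for all $B,\beta_1,\dots,\beta_m,\beta$ as in 2 there is a unique $R$-algebra homomorphism $\varphi\colon A^{(m)}\to B$ with $\varphi\circ\alpha_i=\beta_i$ for all $i$ and $\varphi\circ\alpha=\beta$.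 Consequently, for every Ferrand algebra $(D,\delta_1,\dots,\delta_{m+1})$ of type $(1,\dots,1,n-m)$ there is a unique isomorphism of $R$-algebras $e\colon A^{(m)}\to D$ with $e\circ\alpha_i=\delta_i$ for $i\le m$ and $e\circ\alpha=\delta_{m+1}$. -/

import Mathlib

open scoped TensorProduct

universe u

noncomputable section

/-! ### Determinants over finitely generated projective modules -/

section Determinant

variable {R M : Type*} [CommRing R] [AddCommGroup M] [Module R M]

/-- `b i` and `l i` form a (finite) dual basis of `M`: `x = ∑ i, l i x • b i` for all `x`. -/
def IsDualBasis {ι : Type*} [Fintype ι] (b : ι → M) (l : ι → M →ₗ[R] R) : Prop :=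
  ∀ x : M, ∑ i, l i x • b i = x

/-- A dual basis presents `M` as a direct summand of `R^ι`, and this is the matrix of the
endomorphism of `R^ι` that is `f` on the summand `M` and the identity on the complement. -/
def extendMatrix {ι : Type*} [DecidableEq ι] (b : ι → M) (l : ι → M →ₗ[R] R)
    (f : M →ₗ[R] M) : Matrix ι ι R :=
  1 + Matrix.of fun i j => l i (f (b j) - b j)

theorem det_extendMatrix_eq {ι κ : Type*} [Fintype ι] [DecidableEq ι] [Fintype κ]
    [DecidableEq κ] {b : ι → M} {l : ι → M →ₗ[R] R} (h : IsDualBasis b l)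
    {b' : κ → M} {l' : κ → M →ₗ[R] R} (h' : IsDualBasis b' l') (f : M →ₗ[R] M) :
    (extendMatrix b l f).det = (extendMatrix b' l' f).det := by
  have e1 : extendMatrix b l f = 1 + (Matrix.of fun i k => l i (f (b' k) - b' k)) *
      (Matrix.of fun k j => l' k (b j)) := by
    unfold extendMatrix
    congr 1
    ext i j
    simp only [Matrix.mul_apply, Matrix.of_apply]
    conv_lhs => rw [← h' (b j)]
    simp only [map_sum, map_smul, map_sub, smul_eq_mul, mul_sub, Finset.sum_sub_distrib, mul_comm]
  have e2 : extendMatrix b' l' f = 1 + (Matrix.of fun k j => l' k (b j)) *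
      (Matrix.of fun i k => l i (f (b' k) - b' k)) := by
    unfold extendMatrix
    congr 1
    ext k k'
    simp only [Matrix.mul_apply, Matrix.of_apply]
    conv_lhs => rw [← h (f (b' k') - b' k')]
    simp only [map_sum, map_smul, smul_eq_mul, mul_comm]
  rw [e1, e2, Matrix.det_one_add_mul_comm]

variable (R M) in
theorem exists_isDualBasis [Module.Finite R M] [Module.Projective R M] :
    ∃ (k : ℕ) (b : Fin k → M) (l : Fin k → M →ₗ[R] R), IsDualBasis b l := by
  obtain ⟨k, f, g, -, -, hfg⟩ := Module.Finite.exists_comp_eq_id_of_projective R M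
  refine ⟨k, fun i => f (Pi.single i 1), fun i => LinearMap.proj i ∘ₗ g, fun x => ?_⟩
  have := LinearMap.congr_fun hfg x
  simp only [LinearMap.comp_apply, LinearMap.id_apply] at this
  conv_rhs => rw [← this, ← (LinearMap.sum_single_apply (φ := fun _ : Fin k => R) (g x))]
  rw [map_sum]
  refine Finset.sum_congr rfl fun i _ => ?_
  rw [LinearMap.comp_apply, LinearMap.proj_apply, ← map_smul]
  congr 1
  ext j
  by_cases hj : j = i
  · subst hj; simp
  · simp [hj]

/-- The determinant of an endomorphism of a finitely generated projective module. -/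
def projDet [Module.Finite R M] [Module.Projective R M] (f : M →ₗ[R] M) : R :=
  (extendMatrix (exists_isDualBasis R M).choose_spec.choose
    (exists_isDualBasis R M).choose_spec.choose_spec.choose f).det

theorem projDet_eq_det_extendMatrix [Module.Finite R M] [Module.Projective R M]
    {ι : Type*} [Fintype ι] [DecidableEq ι] {b : ι → M} {l : ι → M →ₗ[R] R}
    (h : IsDualBasis b l) (f : M →ₗ[R] M) : projDet f = (extendMatrix b l f).det :=
  det_extendMatrix_eq (exists_isDualBasis R M).choose_spec.choose_spec.choose_spec h f

/-- On a free module, `projDet` is the usual determinant. -/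
theorem projDet_eq_linearMap_det [Module.Finite R M] [Module.Free R M] (f : M →ₗ[R] M) :
    projDet f = LinearMap.det f := by
  classical
  let b := Module.Free.chooseBasis R M
  have h : IsDualBasis b b.coord := fun x => b.sum_repr x
  rw [projDet_eq_det_extendMatrix h, ← LinearMap.det_toMatrix b]
  congr 1
  ext i j
  simp [extendMatrix, LinearMap.toMatrix_apply, Matrix.one_apply, Finsupp.single_apply, eq_comm]

open Polynomial in
/-- The characteristic polynomial of an endomorphism `f` of a finitely generated projective
module: the determinant of `X - f` on `R[X] ⊗ M`. -/
def projCharpoly [Module.Finite R M] [Module.Projective R M] (f : M →ₗ[R] M) : R[X] :=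
  projDet ((X : R[X]) • LinearMap.id - f.baseChange R[X])

end Determinant

/-! ### Norms -/

theorem IsDualBasis.baseChange {R A : Type*} [CommRing R] [AddCommGroup A] [Module R A]
    {ι : Type*} [Fintype ι] {b : ι → A} {l : ι → A →ₗ[R] R}
    (h : IsDualBasis b l) (T : Type*) [CommRing T] [Algebra R T] :
    IsDualBasis (R := T) (fun i => (1 : T) ⊗ₜ[R] b i)
      (fun i => (TensorProduct.AlgebraTensorModule.rid R T T).toLinearMap ∘ₗ
        (l i).baseChange T) := by
  intro x
  induction x with
  | zero => simp
  | add x y hx hy => simp only [map_add, add_smul, Finset.sum_add_distrib, hx, hy]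
  | tmul t x =>
    conv_rhs => rw [← h x]
    simp [TensorProduct.tmul_sum, TensorProduct.smul_tmul', TensorProduct.tmul_smul]

section Norm

variable {R A : Type*} [CommRing R] [CommRing A] [Algebra R A]
  [Module.Finite R A] [Module.Projective R A]

variable (R) in
/-- The norm of an element of a finite projective algebra. -/
def projNorm (a : A) : R := projDet (LinearMap.mulLeft R a)

variable (R) in
open Polynomial in
/-- The characteristic polynomial `P_a` of an element of a finite projective algebra. -/
def elemCharpoly (a : A) : R[X] := projCharpoly (LinearMap.mulLeft R a)

theorem map_projNorm {S S' : Type*} [CommRing S] [Algebra R S] [CommRing S'] [Algebra R S']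
    (φ : S →ₐ[R] S') (a : S ⊗[R] A) :
    φ (projNorm S a) = projNorm S' (φ.toLinearMap.rTensor A a) := by
  obtain ⟨k, b, l, h⟩ := exists_isDualBasis R A
  have lin (i : Fin k) (x : S ⊗[R] A) :
      φ (TensorProduct.AlgebraTensorModule.rid R S S ((l i).baseChange S x)) =
        TensorProduct.AlgebraTensorModule.rid R S' S'
          ((l i).baseChange S' (φ.toLinearMap.rTensor A x)) := by
    induction x with
    | zero => simp
    | add x y hx hy => simp only [map_add, hx, hy]
    | tmul t x => simp
  have mul (x y : S ⊗[R] A) : φ.toLinearMap.rTensor A (x * y) =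
      φ.toLinearMap.rTensor A x * φ.toLinearMap.rTensor A y :=
    map_mul (Algebra.TensorProduct.map φ (AlgHom.id R A)) x y
  unfold projNorm
  rw [projDet_eq_det_extendMatrix (h.baseChange S), projDet_eq_det_extendMatrix (h.baseChange S'),
    AlgHom.map_det]
  congr 1
  ext i j
  simp [extendMatrix, Matrix.one_apply, apply_ite φ, lin, mul]

end Norm

/-! ### Polynomial laws -/

section Laws

variable {R : Type u} [CommRing R]

/-- A polynomial law `f` is homogeneous of degree `d` if `f (s x) = s ^ d f x`. -/
def PolynomialLaw.IsHomogeneousOfDegree {M N : Type u} [AddCommGroup M] [Module R M]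
    [AddCommGroup N] [Module R N] (f : M →ₚₗ[R] N) (d : ℕ) : Prop :=
  ∀ (S : Type u) [CommSemiring S] [Algebra R S] (s : S) (x : S ⊗[R] M),
    f.toFun' S (s • x) = s ^ d • f.toFun' S x

/-- A linear map seen as a polynomial law. -/
def LinearMap.toPolynomialLaw {M N : Type u} [AddCommGroup M] [Module R M]
    [AddCommGroup N] [Module R N] (f : M →ₗ[R] N) : M →ₚₗ[R] N where
  toFun' S _ _ := f.lTensor S
  isCompat' φ := by
    ext x
    simp only [Function.comp_apply, ← LinearMap.comp_apply, LinearMap.rTensor_comp_lTensor,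
      LinearMap.lTensor_comp_rTensor]

variable {A B C : Type u} [CommRing A] [Algebra R A] [CommRing B] [Algebra R B]
  [CommRing C] [Algebra R C]

/-- A polynomial law between algebras is multiplicative if it preserves products and `1`. -/
def PolynomialLaw.IsMultiplicative (f : A →ₚₗ[R] B) : Prop :=
  ∀ (S : Type u) [CommSemiring S] [Algebra R S],
    (∀ x y : S ⊗[R] A, f.toFun' S (x * y) = f.toFun' S x * f.toFun' S y) ∧ f.toFun' S 1 = 1

/-- The composition of a polynomial law with an algebra homomorphism. -/
def PolynomialLaw.push (φ : B →ₐ[R] C) (f : A →ₚₗ[R] B) : A →ₚₗ[R] C :=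
  PolynomialLaw.comp φ.toLinearMap.toPolynomialLaw f

/-- The product of a finite family of polynomial laws with values in an algebra. -/
def PolynomialLaw.prod {ι : Type*} [Fintype ι] (δ : ι → A →ₚₗ[R] B) : A →ₚₗ[R] B where
  toFun' S _ _ := fun x => ∏ i, (δ i).toFun' S x
  isCompat' {S _ _ S' _ _} φ := by
    ext x
    have := map_prod (Algebra.TensorProduct.map φ (AlgHom.id R B))
      (fun i => (δ i).toFun' S x) Finset.univ
    refine this.trans (Finset.prod_congr rfl fun i _ => ?_)
    exact PolynomialLaw.isCompat_apply' φ x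

variable (R A) in
/-- The norm law `s_n` of a finite projective algebra. An `R`-algebra that is a commutative
semiring is a commutative ring, because `R` is a ring. -/
def normLaw [Module.Finite R A] [Module.Projective R A] : A →ₚₗ[R] R where
  toFun' S _ _ := fun a =>
    letI : CommRing S := (algebraMap R S).commSemiringToCommRing
    projNorm S a ⊗ₜ[R] (1 : R)
  isCompat' {S _ _ S' _ _} φ := by
    ext a
    let : CommRing S := (algebraMap R S).commSemiringToCommRing
    let : CommRing S' := (algebraMap R S').commSemiringToCommRing
    simp only [Function.comp_apply, LinearMap.rTensor_tmul]
    congr 1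
    exact map_projNorm φ a

/-- The laws `δ i` from `A` to `C` have product the norm law of `A`. -/
def FactorsNorm [Module.Finite R A] [Module.Projective R A] {ι : Type*} [Fintype ι]
    (δ : ι → A →ₚₗ[R] C) : Prop :=
  PolynomialLaw.push (Algebra.ofId R C) (normLaw R A) = PolynomialLaw.prod δ

/-- The `δ i` are multiplicative polynomial laws from `A` to `C`, homogeneous of degrees `d i`,
whose product is the norm law of `A`. -/
structure IsNormFactorization [Module.Finite R A] [Module.Projective R A] {ι : Type*} [Fintype ι]
    (d : ι → ℕ) (δ : ι → A →ₚₗ[R] C) : Prop where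
  homogeneous : ∀ i, (δ i).IsHomogeneousOfDegree (d i)
  multiplicative : ∀ i, (δ i).IsMultiplicative
  factorsNorm : FactorsNorm δ

/-- `(C, δ)` is Ferrand's algebra of `A` for the degrees `d`: it is universal for
factorizations of the norm law of `A` into multiplicative homogeneous laws of degrees `d i`. -/
structure IsFerrandAlgebra [Module.Finite R A] [Module.Projective R A] {ι : Type*} [Fintype ι]
    (d : ι → ℕ) (δ : ι → A →ₚₗ[R] C) : Prop where
  isNormFactorization : IsNormFactorization d δ
  universal : ∀ (B : Type u) [CommRing B] [Algebra R B] (β : ι → A →ₚₗ[R] B),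
    IsNormFactorization d β → ∃! φ : C →ₐ[R] B, ∀ i, (δ i).push φ = β i

/-! ### Closures -/

open Polynomial in
/-- For every `R`-algebra `R'` and every `a` in `R' ⊗ A`, the polynomial `∏ s, (X - α s a)`
divides the characteristic polynomial of `a` over `R' ⊗ C`. -/
def SplitsCharpoly [Module.Finite R A] [Module.Projective R A] {σ : Type*} [Fintype σ]
    (α : σ → A →ₐ[R] C) : Prop :=
  ∀ (R' : Type u) [CommRing R'] [Algebra R R'] (a : R' ⊗[R] A),
    ∏ s, ((X : (R' ⊗[R] C)[X]) - Polynomial.C (Algebra.TensorProduct.map (AlgHom.id R R') (α s) a))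
      ∣ (elemCharpoly R' a).map (algebraMap R' (R' ⊗[R] C))

/-- `(C, α)` is a closure of `A` indexed by the finite set `σ`; the `m`-closure is the
case `σ = Fin m`. -/
structure IsClosureOf [Module.Finite R A] [Module.Projective R A] {σ : Type*} [Fintype σ]
    (α : σ → A →ₐ[R] C) : Prop where
  splits : SplitsCharpoly α
  universal : ∀ (B : Type u) [CommRing B] [Algebra R B] (β : σ → A →ₐ[R] B),
    SplitsCharpoly β → ∃! φ : C →ₐ[R] B, ∀ s, φ.comp (α s) = β s

/-- The degrees `(1, …, 1, n - m)`, with `m` ones. -/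
def onesAndRest (n m : ℕ) : Fin (m + 1) → ℕ := Fin.snoc (α := fun _ => ℕ) (fun _ => 1) (n - m)

/-- The family of laws `(α 1, …, α m, β)`, for algebra homomorphisms `α i` and a law `β`. -/
def homsAndLaw {m : ℕ} (α : Fin m → A →ₐ[R] C) (β : A →ₚₗ[R] C) : Fin (m + 1) → A →ₚₗ[R] C :=
  Fin.snoc (α := fun _ => A →ₚₗ[R] C) (fun i => (α i).toLinearMap.toPolynomialLaw) β

end Laws

end

/-! The main device is the shift: an element `x` of `S ⊗ A` is the value at `X = 0` of `X + x`,
which lives over `S[X]`. At `X + x` a product of homomorphisms `β i` becomes `∏ (X + β i x)`, which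
is monic and hence a nonzerodivisor, and the norm becomes the characteristic polynomial of `-x`
(`elemCharpoly_neg`). In a factorization of the norm into the `β i` and a law `μ`, the law is thus
found by cancelling at `X + x` and then setting `X = 0`. So `μ` is unique
(`FactorsNorm.law_unique`), is multiplicative because the norm and the `β i` are, and has degree `n
- m` because the norm has degree `n` (`projNorm_smul`, where the rank enters).

The same evaluation matches factorizations with splittings. Given a factorization, `μ (X + x)` is a
quotient of the characteristic polynomial by `∏ (X + β i x)` (`FactorsNorm.splitsCharpoly`).
Conversely, if the division is exact, the quotient at `X = 0` is a law, since division by monic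
polynomials commutes with base change (`SplitsCharpoly.factorsNorm`). Hence the closure and the
universal factorization represent the same functor. Ferrand's data have multiplicative laws of
degree `1` in place of homomorphisms, but such laws are homomorphisms
(`PolynomialLaw.IsHomogeneousOfDegree.exists_algHom`).

For existence, splitting amounts to the vanishing of one remainder, that of a generic element over a
polynomial ring. The closure is the `m`-fold tensor power of `A` modulo the coordinates of the
coefficients of that remainder. -/

noncomputable section

/-! ### Multiplicativity of the determinant -/

section Determinant

variable {R M : Type*} [CommRing R] [AddCommGroup M] [Module R M]
  [Module.Finite R M] [Module.Projective R M]

theorem projDet_id : projDet (LinearMap.id : M →ₗ[R] M) = 1 := by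
  obtain ⟨k, b, l, h⟩ := exists_isDualBasis R M
  rw [projDet_eq_det_extendMatrix h]
  rw [show extendMatrix b l LinearMap.id = 1 by ext; simp [extendMatrix], Matrix.det_one]

theorem projDet_comp (f g : M →ₗ[R] M) : projDet (f ∘ₗ g) = projDet f * projDet g := by
  obtain ⟨k, b, l, h⟩ := exists_isDualBasis R M
  simp only [projDet_eq_det_extendMatrix h]
  rw [← Matrix.det_mul]
  congr 1
  -- Writing `G u` for the matrix of `u`, the dual basis gives `G u * G v = G (u ∘ v)`, though `G
  -- id` need not be `1`. Then `(1 + G (f - 1)) (1 + G (g - 1)) = 1 + G (f g - 1)`.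
  have key (u v : M →ₗ[R] M) : (Matrix.of fun i j => l i (u (b j))) *
      (Matrix.of fun i j => l i (v (b j))) = Matrix.of fun i j => l i (u (v (b j))) := by
    ext i j
    simp only [Matrix.mul_apply, Matrix.of_apply]
    conv_rhs => rw [← h (v (b j))]
    simp only [map_sum, map_smul, smul_eq_mul, mul_comm]
  have e (u : M →ₗ[R] M) : extendMatrix b l u = 1 + Matrix.of fun i j =>
      l i ((u - LinearMap.id : M →ₗ[R] M) (b j)) := rfl
  rw [e, e, e, add_mul, mul_add, mul_add, key, one_mul, mul_one, one_mul]
  ext i j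
  simp
  ring

end Determinant

/-! ### Change of scalars -/

section ScalarMap

variable {R A : Type*} [CommRing R] [CommRing A] [Algebra R A]

variable (A) in
/-- The base change `S ⊗ A → S' ⊗ A` along a homomorphism of scalars. -/
def scalarMap {S S' : Type*} [CommRing S] [Algebra R S] [CommRing S'] [Algebra R S']
    (φ : S →ₐ[R] S') : S ⊗[R] A →ₐ[R] S' ⊗[R] A :=
  Algebra.TensorProduct.map φ (AlgHom.id R A)

@[simp]
theorem scalarMap_tmul {S S' : Type*} [CommRing S] [Algebra R S] [CommRing S'] [Algebra R S']
    (φ : S →ₐ[R] S') (s : S) (a : A) : scalarMap A φ (s ⊗ₜ a) = φ s ⊗ₜ a := rfl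

theorem scalarMap_smul {S S' : Type*} [CommRing S] [Algebra R S] [CommRing S'] [Algebra R S']
    (φ : S →ₐ[R] S') (s : S) (x : S ⊗[R] A) :
    scalarMap A φ (s • x) = φ s • scalarMap A φ x := by
  induction x with
  | zero => simp
  | add x y hx hy => simp only [smul_add, map_add, hx, hy]
  | tmul t x => simp [TensorProduct.smul_tmul']

theorem scalarMap_scalarMap {S S' S'' : Type*} [CommRing S] [Algebra R S] [CommRing S']
    [Algebra R S'] [CommRing S''] [Algebra R S''] (φ : S →ₐ[R] S') (ψ : S' →ₐ[R] S'')
    (x : S ⊗[R] A) : scalarMap A ψ (scalarMap A φ x) = scalarMap A (ψ.comp φ) x := by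
  induction x with
  | zero => simp
  | add x y hx hy => simp only [map_add, hx, hy]
  | tmul t x => simp

@[simp]
theorem scalarMap_id {S : Type*} [CommRing S] [Algebra R S] (x : S ⊗[R] A) :
    scalarMap A (AlgHom.id R S) x = x := by
  simp [scalarMap]

end ScalarMap

/-! ### Norms and characteristic polynomials -/

section Norm

variable {R A : Type*} [CommRing R] [CommRing A] [Algebra R A]
  [Module.Finite R A] [Module.Projective R A]

theorem projNorm_one : projNorm R (1 : A) = 1 := by
  rw [projNorm, LinearMap.mulLeft_one, projDet_id]

theorem projNorm_mul (a b : A) : projNorm R (a * b) = projNorm R a * projNorm R b := by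
  rw [projNorm, LinearMap.mulLeft_mul, projDet_comp]; rfl

theorem map_projNorm' {S S' : Type*} [CommRing S] [Algebra R S] [CommRing S'] [Algebra R S']
    (φ : S →ₐ[R] S') (a : S ⊗[R] A) : φ (projNorm S a) = projNorm S' (scalarMap A φ a) :=
  map_projNorm φ a

/-- The identity may be checked after localizing `S` at each maximal ideal. There the base change of
`A` is free, of rank `n` by the hypothesis at the image of the closed point in `Spec R`, and the
usual determinant formula applies. -/
theorem projNorm_smul {n : ℕ} (hA : ∀ p : PrimeSpectrum R, Module.rankAtStalk A p = n)
    (S : Type*) [CommRing S] [Algebra R S] (s : S) (a : S ⊗[R] A) :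
    projNorm S (s • a) = s ^ n * projNorm S a := by
  refine Module.eq_of_localization_maximal (R := S) (M := S)
    (fun P _ => Localization.AtPrime P)
    (fun P _ => Algebra.linearMap S (Localization.AtPrime P)) _ _ fun P _ => ?_
  simp only [Algebra.linearMap_apply, map_mul, map_pow]
  let φ : S →ₐ[R] Localization.AtPrime P := IsScalarTower.toAlgHom R S _
  have hφ (x : S) : algebraMap S (Localization.AtPrime P) x = φ x := rfl
  simp only [hφ, map_projNorm', scalarMap_smul]
  generalize scalarMap A φ a = b
  generalize φ s = t
  have : Module.Free (Localization.AtPrime P) (Localization.AtPrime P ⊗[R] A) :=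
    Module.free_of_flat_of_isLocalRing
  have hr : Module.finrank (Localization.AtPrime P) (Localization.AtPrime P ⊗[R] A) = n := by
    let p : PrimeSpectrum (Localization.AtPrime P) := IsLocalRing.closedPoint _
    rw [← hA (p.comap (algebraMap R _)), ← Module.rankAtStalk_baseChange,
      Module.rankAtStalk_eq_finrank_of_free]
    rfl
  rw [projNorm, projNorm, projDet_eq_linearMap_det, projDet_eq_linearMap_det,
    ← hr, ← LinearMap.det_smul]
  congr 1
  ext
  simp

open Polynomial in
-- The left side is a determinant on `S[X] ⊗ (S ⊗ A)`, the right side one on `S[X] ⊗ A`. Dual bases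
-- induced from a single one of `A` give both the same matrix.
theorem elemCharpoly_eq_projNorm (S : Type*) [CommRing S] [Algebra R S] (a : S ⊗[R] A) :
    elemCharpoly S a = projNorm S[X]
      ((X : S[X]) ⊗ₜ[R] (1 : A) - scalarMap A (IsScalarTower.toAlgHom R S S[X]) a) := by
  obtain ⟨k, b, l, h⟩ := exists_isDualBasis R A
  rw [elemCharpoly, projCharpoly, projNorm,
    projDet_eq_det_extendMatrix ((h.baseChange S).baseChange S[X]),
    projDet_eq_det_extendMatrix (h.baseChange S[X])]
  congr 1
  ext1 i j
  have key : C ((TensorProduct.AlgebraTensorModule.rid R S S) ((l i).baseChange S (a * 1 ⊗ₜ b j)))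
      = (TensorProduct.AlgebraTensorModule.rid R S[X] S[X]) ((l i).baseChange S[X]
        (scalarMap A (IsScalarTower.toAlgHom R S S[X]) a * 1 ⊗ₜ b j)) := by
    induction a with
    | zero => simp
    | add x y hx hy => simp only [add_mul, map_add, hx, hy]
    | tmul t x => simp [Algebra.smul_def]
  simp [extendMatrix, sub_mul, TensorProduct.smul_tmul', ← key, Algebra.smul_def]

end Norm

/-! ### Polynomial scalars and the shift `X + x` -/

section PolyTensor

open Polynomial

variable {R A B S : Type*} [CommRing R] [CommRing A] [Algebra R A] [CommRing B] [Algebra R B]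
  [CommRing S] [Algebra R S]

variable (S) in
/-- The base change to `S` of a homomorphism of `R`-algebras. -/
def valueMap (β : A →ₐ[R] B) : S ⊗[R] A →ₐ[R] S ⊗[R] B :=
  Algebra.TensorProduct.map (AlgHom.id R S) β

@[simp]
theorem valueMap_tmul (β : A →ₐ[R] B) (s : S) (a : A) :
    valueMap S β (s ⊗ₜ a) = s ⊗ₜ β a := rfl

theorem valueMap_scalarMap {S' : Type*} [CommRing S'] [Algebra R S'] (φ : S →ₐ[R] S')
    (β : A →ₐ[R] B) (x : S ⊗[R] A) :
    valueMap S' β (scalarMap A φ x) = scalarMap B φ (valueMap S β x) := by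
  induction x with
  | zero => simp
  | add x y hx hy => simp only [map_add, hx, hy]
  | tmul t x => simp

theorem valueMap_smul (β : A →ₐ[R] B) (s : S) (x : S ⊗[R] A) :
    valueMap S β (s • x) = s • valueMap S β x := by
  induction x with
  | zero => simp
  | add x y hx hy => simp only [smul_add, map_add, hx, hy]
  | tmul t x => simp [TensorProduct.smul_tmul']

theorem valueMap_valueMap {C : Type*} [CommRing C] [Algebra R C] (β : A →ₐ[R] B)
    (γ : B →ₐ[R] C) (x : S ⊗[R] A) :
    valueMap S γ (valueMap S β x) = valueMap S (γ.comp β) x := by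
  induction x with
  | zero => simp
  | add x y hx hy => simp only [map_add, hx, hy]
  | tmul t x => simp

@[simp]
theorem valueMap_algebraMap (β : A →ₐ[R] B) (s : S) :
    valueMap S β (algebraMap S (S ⊗[R] A) s) = algebraMap S (S ⊗[R] B) s := by
  simp [Algebra.TensorProduct.algebraMap_apply]

variable (R S) in
/-- The inclusion of the constant polynomials. -/
def constHom : S →ₐ[R] S[X] := IsScalarTower.toAlgHom R S S[X]

@[simp]
theorem constHom_apply (s : S) : constHom R S s = C s := rfl

variable (R S) in
/-- Evaluation at `0`. -/
def evalZero : S[X] →ₐ[R] S := (aeval (0 : S)).restrictScalars R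

@[simp]
theorem evalZero_apply (p : S[X]) : evalZero R S p = p.eval 0 := rfl

theorem evalZero_comp_constHom : (evalZero R S).comp (constHom R S) = AlgHom.id R S := by
  ext; simp

variable (R B S) in
/-- The inverse of `polyTensor`. -/
def polyTensorInv : (S ⊗[R] B)[X] →ₐ[R] S[X] ⊗[R] B :=
  eval₂AlgHom (scalarMap B (constHom R S)) (X ⊗ₜ[R] (1 : B)) fun _ => Commute.all _ _

@[simp]
theorem polyTensorInv_C (y : S ⊗[R] B) :
    polyTensorInv R B S (C y) = scalarMap B (constHom R S) y :=
  eval₂_C _ _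

@[simp]
theorem polyTensorInv_X : polyTensorInv R B S X = X ⊗ₜ[R] (1 : B) :=
  eval₂_X _ _

variable (R B S) in
/-- The isomorphism `S[X] ⊗ B ≃ (S ⊗ B)[X]`. -/
def polyTensor : S[X] ⊗[R] B ≃ₐ[R] (S ⊗[R] B)[X] :=
  AlgEquiv.ofAlgHom
    (Algebra.TensorProduct.lift
      (Polynomial.mapAlgHom (Algebra.TensorProduct.includeLeft : S →ₐ[R] S ⊗[R] B))
      ((constHom R (S ⊗[R] B)).comp Algebra.TensorProduct.includeRight)
      fun _ _ => Commute.all _ _)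
    (polyTensorInv R B S)
    (by
      refine Polynomial.algHom_ext' ?_ ?_
      · ext <;> simp [← Algebra.TensorProduct.one_def]
      · simp [← Algebra.TensorProduct.one_def])
    (by
      ext
      · simp
      · simp
      · simp)

@[simp]
theorem polyTensor_tmul (p : S[X]) (b : B) :
    polyTensor R B S (p ⊗ₜ b) = p.map (algebraMap S (S ⊗[R] B)) * C (1 ⊗ₜ b) := by
  rfl

theorem polyTensor_scalarMap (y : S ⊗[R] B) :
    polyTensor R B S (scalarMap B (constHom R S) y) = C y := by
  induction y with
  | zero => simp
  | add x y hx hy => simp only [map_add, hx, hy]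
  | tmul t x => simp [← map_mul]

theorem polyTensor_algebraMap (p : S[X]) :
    polyTensor R B S (algebraMap S[X] _ p) = p.map (algebraMap S (S ⊗[R] B)) := by
  simp [Algebra.TensorProduct.algebraMap_apply, ← Algebra.TensorProduct.one_def]

variable (R) in
/-- The element `X + x` of `S[X] ⊗ A`. -/
def shift (x : S ⊗[R] A) : S[X] ⊗[R] A := X ⊗ₜ 1 + scalarMap A (constHom R S) x

theorem scalarMap_evalZero_shift (x : S ⊗[R] A) : scalarMap A (evalZero R S) (shift R x) = x := by
  simp [shift, scalarMap_scalarMap, evalZero_comp_constHom]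

theorem scalarMap_shift {S' : Type*} [CommRing S'] [Algebra R S'] (φ : S →ₐ[R] S')
    (x : S ⊗[R] A) : scalarMap A (mapAlgHom φ) (shift R x) = shift R (scalarMap A φ x) := by
  simp only [shift, map_add, scalarMap_tmul, scalarMap_scalarMap, coe_mapAlgHom, map_X]
  congr 2
  refine congrArg (fun f : S →ₐ[R] S'[X] => scalarMap A f) ?_
  ext
  simp

theorem polyTensor_valueMap_shift (β : A →ₐ[R] B) (x : S ⊗[R] A) :
    polyTensor R B S (valueMap S[X] β (shift R x)) = X + C (valueMap S β x) := by
  simp [shift, valueMap_scalarMap, polyTensor_scalarMap, ← Algebra.TensorProduct.one_def]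

/-- Under `polyTensor` each factor is the monic polynomial `X + β i x`. This is what allows
cancellation in a factorization of the norm. -/
theorem prod_valueMap_shift_mem_nonZeroDivisors {σ : Type*} [Fintype σ] (β : σ → A →ₐ[R] B)
    (x : S ⊗[R] A) :
    ∏ i, valueMap S[X] (β i) (shift R x) ∈ nonZeroDivisors (S[X] ⊗[R] B) := by
  refine prod_mem fun i _ => ?_
  have h : X + C (valueMap S (β i) x) ∈ nonZeroDivisors (S ⊗[R] B)[X] :=
    (monic_X_add_C _).mem_nonZeroDivisors
  rw [← polyTensor_valueMap_shift] at h
  exact mem_nonZeroDivisors_of_injective (polyTensor R B S).injective h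

theorem map_projNorm_shift [Module.Finite R A] [Module.Projective R A] {S' : Type*} [CommRing S']
    [Algebra R S'] (φ : S →ₐ[R] S') (x : S ⊗[R] A) :
    (projNorm S[X] (shift R x)).map (φ : S →+* S') =
      projNorm S'[X] (shift R (scalarMap A φ x)) := by
  rw [← scalarMap_shift, ← map_projNorm']
  rfl

theorem elemCharpoly_neg [Module.Finite R A] [Module.Projective R A] (a : S ⊗[R] A) :
    elemCharpoly S (-a) = projNorm S[X] (shift R a) := by
  rw [elemCharpoly_eq_projNorm, map_neg, sub_neg_eq_add]
  rfl

theorem map_elemCharpoly [Module.Finite R A] [Module.Projective R A] {S' : Type*} [CommRing S']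
    [Algebra R S'] (φ : S →ₐ[R] S') (x : S ⊗[R] A) :
    (elemCharpoly S x).map (φ : S →+* S') = elemCharpoly S' (scalarMap A φ x) := by
  rw [← neg_neg x, map_neg, elemCharpoly_neg, elemCharpoly_neg, map_projNorm_shift]

end PolyTensor

/-! ### Factorizations of the norm and splittings of the characteristic polynomial -/

section Laws

open Polynomial

variable {R : Type u} [CommRing R] {A B C : Type u} [CommRing A] [Algebra R A]
  [CommRing B] [Algebra R B] [CommRing C] [Algebra R C]

theorem PolynomialLaw.ext_of_commRing {f g : A →ₚₗ[R] B}
    (h : ∀ (S : Type u) [CommRing S] [Algebra R S] (x : S ⊗[R] A), f.toFun' S x = g.toFun' S x) :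
    f = g := by
  ext S _ _ x
  let : CommRing S := (algebraMap R S).commSemiringToCommRing
  exact h S x

theorem PolynomialLaw.scalarMap_toFun' (f : A →ₚₗ[R] B) {S S' : Type u} [CommRing S] [Algebra R S]
    [CommRing S'] [Algebra R S'] (φ : S →ₐ[R] S') (x : S ⊗[R] A) :
    scalarMap B φ (f.toFun' S x) = f.toFun' S' (scalarMap A φ x) :=
  f.isCompat_apply' φ x

theorem PolynomialLaw.toFun'_eq_scalarMap_shift (f : A →ₚₗ[R] B) {S : Type u} [CommRing S]
    [Algebra R S] (x : S ⊗[R] A) :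
    f.toFun' S x = scalarMap B (evalZero R S) (f.toFun' S[X] (shift R x)) := by
  rw [f.scalarMap_toFun', scalarMap_evalZero_shift]

theorem PolynomialLaw.push_toFun' (φ : B →ₐ[R] C) (f : A →ₚₗ[R] B) (S : Type u) [CommRing S]
    [Algebra R S] (x : S ⊗[R] A) : (f.push φ).toFun' S x = valueMap S φ (f.toFun' S x) := rfl

theorem AlgHom.toPolynomialLaw_toFun' (φ : B →ₐ[R] C) (S : Type u) [CommRing S]
    [Algebra R S] (x : S ⊗[R] B) :
    φ.toLinearMap.toPolynomialLaw.toFun' S x = valueMap S φ x := rfl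

theorem PolynomialLaw.push_comp {D : Type u} [CommRing D] [Algebra R D] (φ : B →ₐ[R] C)
    (ψ : C →ₐ[R] D) (f : A →ₚₗ[R] B) : (f.push φ).push ψ = f.push (ψ.comp φ) :=
  PolynomialLaw.ext_of_commRing fun _ _ _ _ => valueMap_valueMap _ _ _

theorem PolynomialLaw.push_id (f : A →ₚₗ[R] B) : f.push (AlgHom.id R B) = f :=
  PolynomialLaw.ext_of_commRing fun S _ _ x => by
    rw [push_toFun']
    exact congrArg (fun h : S ⊗[R] B →ₐ[R] S ⊗[R] B => h (f.toFun' S x))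
      (Algebra.TensorProduct.map_id)

theorem AlgHom.push_toPolynomialLaw (φ : A →ₐ[R] B) (ψ : B →ₐ[R] C) :
    φ.toLinearMap.toPolynomialLaw.push ψ = (ψ.comp φ).toLinearMap.toPolynomialLaw :=
  PolynomialLaw.ext_of_commRing fun _ _ _ _ => valueMap_valueMap _ _ _

theorem AlgHom.toPolynomialLaw_injective {φ ψ : A →ₐ[R] B}
    (h : φ.toLinearMap.toPolynomialLaw = ψ.toLinearMap.toPolynomialLaw) : φ = ψ := by
  ext a
  have := congrArg (fun f : A →ₚₗ[R] B => TensorProduct.lid R B (f.toFun' R (1 ⊗ₜ a))) h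
  simpa [AlgHom.toPolynomialLaw_toFun'] using this

theorem AlgHom.toPolynomialLaw_isMultiplicative (φ : A →ₐ[R] B) :
    φ.toLinearMap.toPolynomialLaw.IsMultiplicative := by
  intro S _ _
  let : CommRing S := (algebraMap R S).commSemiringToCommRing
  exact ⟨map_mul (valueMap S φ), map_one (valueMap S φ)⟩

theorem AlgHom.toPolynomialLaw_isHomogeneous (φ : A →ₐ[R] B) :
    φ.toLinearMap.toPolynomialLaw.IsHomogeneousOfDegree 1 := by
  intro S _ _ s x
  let : CommRing S := (algebraMap R S).commSemiringToCommRing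
  rw [pow_one]
  exact valueMap_smul φ s x

theorem homsAndLaw_push {m : ℕ} (β : Fin m → A →ₐ[R] B) (μ : A →ₚₗ[R] B) (φ : B →ₐ[R] C) :
    (fun i => (homsAndLaw β μ i).push φ) =
      homsAndLaw (fun i => φ.comp (β i)) (μ.push φ) := by
  ext1 i
  refine Fin.lastCases ?_ (fun i => ?_) i
  · simp only [homsAndLaw, Fin.snoc_last]
  · simp only [homsAndLaw, Fin.snoc_castSucc, AlgHom.push_toPolynomialLaw]

variable [Module.Finite R A] [Module.Projective R A]

/-- The law is defined with a ring structure rebuilt from the semiring `S`. Naturality of the norm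
along the identity of `S` compares it with the given one. -/
theorem normLaw_toFun' (S : Type u) [CommRing S] [Algebra R S] (x : S ⊗[R] A) :
    (normLaw R A).toFun' S x = projNorm S x ⊗ₜ 1 := by
  have h := @map_projNorm R A _ _ _ _ _ S S (algebraMap R S).commSemiringToCommRing _ _ _
    (AlgHom.id R S) x
  rw [show (AlgHom.id R S).toLinearMap.rTensor A x = x from scalarMap_id x] at h
  exact congrArg (· ⊗ₜ (1 : R)) h

theorem factorsNorm_iff {ι : Type*} [Fintype ι] (δ : ι → A →ₚₗ[R] C) :
    FactorsNorm δ ↔ ∀ (S : Type u) [CommRing S] [Algebra R S] (x : S ⊗[R] A),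
      algebraMap S (S ⊗[R] C) (projNorm S x) = ∏ i, (δ i).toFun' S x := by
  have key (S : Type u) [CommRing S] [Algebra R S] (x : S ⊗[R] A) :
      ((normLaw R A).push (Algebra.ofId R C)).toFun' S x =
        algebraMap S (S ⊗[R] C) (projNorm S x) := by
    rw [PolynomialLaw.push_toFun', normLaw_toFun', valueMap_tmul, map_one]; rfl
  constructor
  · intro h S _ _ x
    rw [← key, h]; rfl
  · intro h
    refine PolynomialLaw.ext_of_commRing fun S _ _ x => ?_
    rw [key, h]; rfl

theorem factorsNorm_homsAndLaw_iff {m : ℕ} (β : Fin m → A →ₐ[R] B) (μ : A →ₚₗ[R] B) :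
    FactorsNorm (homsAndLaw β μ) ↔ ∀ (S : Type u) [CommRing S] [Algebra R S] (x : S ⊗[R] A),
      algebraMap S (S ⊗[R] B) (projNorm S x) = (∏ i, valueMap S (β i) x) * μ.toFun' S x := by
  rw [factorsNorm_iff]
  simp only [homsAndLaw, Fin.prod_univ_castSucc, Fin.snoc_castSucc, Fin.snoc_last]
  rfl

variable {m : ℕ} {β : Fin m → A →ₐ[R] B} {μ : A →ₚₗ[R] B}

theorem FactorsNorm.push {ι : Type*} [Fintype ι] {δ : ι → A →ₚₗ[R] B} (h : FactorsNorm δ)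
    (φ : B →ₐ[R] C) : FactorsNorm fun i => (δ i).push φ := by
  rw [factorsNorm_iff] at h ⊢
  intro S _ _ x
  have := congrArg (valueMap S φ) (h S x)
  rwa [valueMap_algebraMap, map_prod] at this

/-- The law completing a family of homomorphisms to a factorization of the norm is unique. -/
theorem FactorsNorm.law_unique {μ' : A →ₚₗ[R] B} (h : FactorsNorm (homsAndLaw β μ))
    (h' : FactorsNorm (homsAndLaw β μ')) : μ = μ' := by
  rw [factorsNorm_homsAndLaw_iff] at h h'
  refine PolynomialLaw.ext_of_commRing fun S _ _ x => ?_
  rw [μ.toFun'_eq_scalarMap_shift, μ'.toFun'_eq_scalarMap_shift]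
  congr 1
  refine (mul_cancel_left_mem_nonZeroDivisors (prod_valueMap_shift_mem_nonZeroDivisors β x)).1 ?_
  rw [← h, ← h']

theorem FactorsNorm.isMultiplicative (h : FactorsNorm (homsAndLaw β μ)) :
    μ.IsMultiplicative := by
  rw [factorsNorm_homsAndLaw_iff] at h
  intro S _ _
  let : CommRing S := (algebraMap R S).commSemiringToCommRing
  constructor
  · intro x y
    have hx := scalarMap_evalZero_shift (R := R) (S := S) x
    have hy := scalarMap_evalZero_shift (R := R) (S := S) y
    conv_lhs => rw [← hx, ← hy, ← map_mul, ← μ.scalarMap_toFun']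
    rw [μ.toFun'_eq_scalarMap_shift x, μ.toFun'_eq_scalarMap_shift y, ← map_mul]
    congr 1
    -- Both arguments are shifted separately, so the identity is proved for `(X + x) (X + y)`, where
    -- both products of the `β i` can be cancelled.
    refine (mul_cancel_left_mem_nonZeroDivisors (mul_mem
      (prod_valueMap_shift_mem_nonZeroDivisors β x)
      (prod_valueMap_shift_mem_nonZeroDivisors β y))).1 ?_
    rw [mul_mul_mul_comm, ← h, ← h, ← map_mul, ← projNorm_mul, h]
    simp only [map_mul, Finset.prod_mul_distrib]
  · simpa only [projNorm_one, map_one, Finset.prod_const_one, one_mul] using (h S 1).symm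

/-- Homogeneity is first proved where cancellation is possible: the norm scales by `s ^ n` and the
product of the `β i` by `s ^ m`. The conditions on `s` and on `x` are then removed one at a time. -/
theorem FactorsNorm.toFun'_smul_of_mem_nonZeroDivisors {n : ℕ}
    (hA : ∀ p : PrimeSpectrum R, Module.rankAtStalk A p = n) (hmn : m ≤ n)
    (h : FactorsNorm (homsAndLaw β μ)) {S : Type u} [CommRing S] [Algebra R S] {s : S}
    (hs : algebraMap S (S ⊗[R] B) s ∈ nonZeroDivisors (S ⊗[R] B)) {x : S ⊗[R] A}
    (hx : ∏ i, valueMap S (β i) x ∈ nonZeroDivisors (S ⊗[R] B)) :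
    μ.toFun' S (s • x) = s ^ (n - m) • μ.toFun' S x := by
  rw [factorsNorm_homsAndLaw_iff] at h
  refine (mul_cancel_left_mem_nonZeroDivisors (mul_mem (pow_mem hs m) hx)).1 ?_
  have h1 := h S (s • x)
  rw [projNorm_smul hA, map_mul, h] at h1
  have h2 : ∏ i, valueMap S (β i) (s • x) =
      algebraMap S (S ⊗[R] B) s ^ m * ∏ i, valueMap S (β i) x := by
    simp only [valueMap_smul]
    simp only [Algebra.smul_def, Finset.prod_mul_distrib, Finset.prod_const, Finset.card_univ,
      Fintype.card_fin]
  rw [← h2, ← h1, Algebra.smul_def (s ^ (n - m)) (μ.toFun' S x), h2,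
    ← Nat.add_sub_cancel' hmn, Nat.add_sub_cancel_left, pow_add, map_mul, map_pow, map_pow]
  ring

/-- The scalar `s` is a specialization of the variable `X` of `S[X]`, which is a nonzerodivisor. -/
theorem FactorsNorm.toFun'_smul_of_prod_mem_nonZeroDivisors {n : ℕ}
    (hA : ∀ p : PrimeSpectrum R, Module.rankAtStalk A p = n) (hmn : m ≤ n)
    (h : FactorsNorm (homsAndLaw β μ)) {S : Type u} [CommRing S] [Algebra R S] (s : S)
    {x : S ⊗[R] A} (hx : ∏ i, valueMap S (β i) x ∈ nonZeroDivisors (S ⊗[R] B)) :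
    μ.toFun' S (s • x) = s ^ (n - m) • μ.toFun' S x := by
  let ψ : S[X] →ₐ[R] S := (aeval s).restrictScalars R
  have hψ (y : S ⊗[R] A) : scalarMap A ψ (scalarMap A (constHom R S) y) = y := by
    rw [scalarMap_scalarMap, show ψ.comp (constHom R S) = AlgHom.id R S by ext; simp [ψ],
      scalarMap_id]
  have key := h.toFun'_smul_of_mem_nonZeroDivisors hA hmn (S := S[X]) (s := X)
    (x := scalarMap A (constHom R S) x) ?_ ?_
  · have := congrArg (scalarMap B ψ) key
    simpa only [scalarMap_smul, PolynomialLaw.scalarMap_toFun', hψ, map_pow,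
      show ψ X = s from aeval_X s] using this
  · refine mem_nonZeroDivisors_of_injective (polyTensor R B S).injective ?_
    rw [polyTensor_algebraMap, map_X]
    exact monic_X.mem_nonZeroDivisors
  · refine mem_nonZeroDivisors_of_injective (polyTensor R B S).injective ?_
    simp only [valueMap_scalarMap, ← map_prod, polyTensor_scalarMap]
    refine mem_nonZeroDivisors_iff_right.2 fun p hp => ?_
    ext k
    have := congrArg (coeff · k) hp
    rw [coeff_mul_C, coeff_zero] at this
    exact (mul_right_mem_nonZeroDivisors_eq_zero_iff hx).1 this

theorem FactorsNorm.isHomogeneous {n : ℕ} (hA : ∀ p : PrimeSpectrum R, Module.rankAtStalk A p = n)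
    (hmn : m ≤ n) (h : FactorsNorm (homsAndLaw β μ)) : μ.IsHomogeneousOfDegree (n - m) := by
  intro S _ _ s x
  let : CommRing S := (algebraMap R S).commSemiringToCommRing
  -- The condition on `x` is removed by passing to `X + x` with the constant scalar `C s`.
  have key := congrArg (scalarMap B (evalZero R S))
    (h.toFun'_smul_of_prod_mem_nonZeroDivisors hA hmn (S := S[X]) (Polynomial.C s)
      (x := shift R x) (prod_valueMap_shift_mem_nonZeroDivisors β x))
  simpa only [scalarMap_smul, PolynomialLaw.scalarMap_toFun', scalarMap_evalZero_shift, map_pow,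
    evalZero_apply, eval_C] using key

/-- The quotient of the characteristic polynomial of `-x` by `∏ i, (X + α i x)`. -/
def residualPoly (α : Fin m → A →ₐ[R] C) (S : Type u) [CommRing S] [Algebra R S] (x : S ⊗[R] A) :
    (S ⊗[R] C)[X] :=
  (projNorm S[X] (shift R x)).map (algebraMap S (S ⊗[R] C)) /ₘ
    ∏ i, (X + Polynomial.C (valueMap S (α i) x))

/-- Division with remainder by a monic polynomial commutes with ring maps, whether or not it is
exact. So the quotient is natural in `S` and its value at `0` is a polynomial law. -/
theorem map_residualPoly (α : Fin m → A →ₐ[R] C) {S S' : Type u} [CommRing S] [Algebra R S]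
    [CommRing S'] [Algebra R S'] (φ : S →ₐ[R] S') (x : S ⊗[R] A) :
    (residualPoly α S x).map (scalarMap C φ).toRingHom = residualPoly α S' (scalarMap A φ x) := by
  rw [residualPoly, map_divByMonic _ (monic_prod_of_monic _ _ fun i _ => monic_X_add_C _),
    residualPoly, ← map_projNorm_shift, Polynomial.map_prod, map_map, map_map]
  congr 2
  ext1 i
  simp [valueMap_scalarMap]

/-- The law completing homomorphisms that split the characteristic polynomials. -/
def residualLaw (α : Fin m → A →ₐ[R] C) : A →ₚₗ[R] C where
  toFun' S _ _ x :=
    letI : CommRing S := (algebraMap R S).commSemiringToCommRing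
    (residualPoly α S x).eval 0
  isCompat' {S _ _ S' _ _} φ := by
    ext x
    let : CommRing S := (algebraMap R S).commSemiringToCommRing
    let : CommRing S' := (algebraMap R S').commSemiringToCommRing
    have := congrArg (eval 0) (map_residualPoly α φ x)
    rw [eval_zero_map] at this
    exact this

theorem residualLaw_toFun' (α : Fin m → A →ₐ[R] C) (S : Type u) [CommRing S] [Algebra R S]
    (x : S ⊗[R] A) : (residualLaw α).toFun' S x = (residualPoly α S x).eval 0 := by
  have := congrArg (eval 0) (@map_residualPoly _ _ _ _ _ _ _ _ _ _ _ α S S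
    (algebraMap R S).commSemiringToCommRing _ _ _ (AlgHom.id R S) x)
  rw [eval_zero_map] at this
  exact (scalarMap_id _).symm.trans (this.trans
    (congrArg (fun y => eval 0 (residualPoly α S y)) (scalarMap_id x)))

theorem splitsCharpoly_iff {σ : Type*} [Fintype σ] (α : σ → A →ₐ[R] C) :
    SplitsCharpoly α ↔ ∀ (S : Type u) [CommRing S] [Algebra R S] (x : S ⊗[R] A),
      ∏ i, (X - Polynomial.C (valueMap S (α i) x)) ∣
        (elemCharpoly S x).map (algebraMap S (S ⊗[R] C)) := Iff.rfl

theorem splitsCharpoly_iff_shift (α : Fin m → A →ₐ[R] C) :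
    SplitsCharpoly α ↔ ∀ (S : Type u) [CommRing S] [Algebra R S] (x : S ⊗[R] A),
      ∏ i, (X + Polynomial.C (valueMap S (α i) x)) ∣
        (projNorm S[X] (shift R x)).map (algebraMap S (S ⊗[R] C)) := by
  rw [splitsCharpoly_iff]
  constructor
  · intro h S _ _ x
    simpa only [map_neg, sub_neg_eq_add, elemCharpoly_neg] using h S (-x)
  · intro h S _ _ x
    have := h S (-x)
    simpa only [map_neg, ← sub_eq_add_neg, ← elemCharpoly_neg, neg_neg] using this

theorem FactorsNorm.splitsCharpoly (h : FactorsNorm (homsAndLaw β μ)) : SplitsCharpoly β := by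
  rw [factorsNorm_homsAndLaw_iff] at h
  rw [splitsCharpoly_iff_shift]
  intro S _ _ x
  have := congrArg (polyTensor R B S) (h S[X] (shift R x))
  simp only [polyTensor_algebraMap, map_mul, map_prod, polyTensor_valueMap_shift] at this
  exact ⟨_, this⟩

theorem SplitsCharpoly.factorsNorm {α : Fin m → A →ₐ[R] C} (h : SplitsCharpoly α) :
    FactorsNorm (homsAndLaw α (residualLaw α)) := by
  rw [splitsCharpoly_iff_shift] at h
  rw [factorsNorm_homsAndLaw_iff]
  intro S _ _ x
  have hq : (∏ i, (X + Polynomial.C (valueMap S (α i) x))) * residualPoly α S x =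
      (projNorm S[X] (shift R x)).map (algebraMap S (S ⊗[R] C)) := by
    have hm : (∏ i, (X + Polynomial.C (valueMap S (α i) x))).Monic :=
      monic_prod_of_monic _ _ fun i _ => monic_X_add_C _
    have := modByMonic_add_div
      ((projNorm S[X] (shift R x)).map (algebraMap S (S ⊗[R] C)))
      (∏ i, (X + Polynomial.C (valueMap S (α i) x)))
    rwa [(modByMonic_eq_zero_iff_dvd hm).2 (h S x), zero_add] at this
  have h0 := congrArg (eval 0) hq
  rw [eval_mul, eval_prod, eval_zero_map, ← evalZero_apply (R := R) (projNorm _ _),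
    map_projNorm', scalarMap_evalZero_shift] at h0
  simpa [residualLaw_toFun'] using h0.symm

end Laws

/-! ### Multiplicative laws of degree one are homomorphisms -/

section DegreeOne

variable {R : Type u} [CommRing R] {A B : Type u} [CommRing A] [Algebra R A]
  [CommRing B] [Algebra R B]

open Polynomial in
-- The value of `f` at the generic combination `z = T₀ x + T₁ y` over `S[T₀, T₁]` is multiplied by
-- `X` under `Tᵢ ↦ X Tᵢ`, so it is linear in the `Tᵢ`. Specializing `(T₀, T₁)` to `(1, 0)`, `(0, 1)`
-- and `(1, 1)` gives additivity.
theorem PolynomialLaw.IsHomogeneousOfDegree.toFun'_add {f : A →ₚₗ[R] B}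
    (hf : f.IsHomogeneousOfDegree 1) {S : Type u} [CommRing S] [Algebra R S] (x y : S ⊗[R] A) :
    f.toFun' S (x + y) = f.toFun' S x + f.toFun' S y := by
  let P := MvPolynomial (Fin 2) S
  let c : S →ₐ[R] P := IsScalarTower.toAlgHom R S P
  let z : P ⊗[R] A := (MvPolynomial.X 0 : P) • scalarMap A c x +
    (MvPolynomial.X 1 : P) • scalarMap A c y
  let φ : P →ₐ[R] P[X] := (MvPolynomial.aeval fun i => (Polynomial.X * Polynomial.C
    (MvPolynomial.X i) : P[X]) : P →ₐ[S] P[X]).restrictScalars R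
  let κ : P →ₐ[R] P[X] := constHom R P
  let ev (v : Fin 2 → S) : P →ₐ[R] S := (MvPolynomial.aeval v : P →ₐ[S] S).restrictScalars R
  let cf (i : Fin 2) : P →ₗ[R] S := (MvPolynomial.lcoeff S (Finsupp.single i 1)).restrictScalars R
  -- Takes the coefficient of `X` and sets `T = v`. Applied to the two sides of `key`, it yields the
  -- linear part at `v` (`h2`) and the full value at `v` (`h1`).
  let ℓ (v : Fin 2 → S) : P[X] →ₗ[R] S :=
    (ev v).toLinearMap ∘ₗ (Polynomial.lcoeff P 1).restrictScalars R
  have hφ : scalarMap A φ z = (Polynomial.X : P[X]) • scalarMap A κ z := by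
    have hc (t : S ⊗[R] A) : scalarMap A φ (scalarMap A c t) = scalarMap A κ (scalarMap A c t) := by
      rw [scalarMap_scalarMap, scalarMap_scalarMap]
      refine congrArg (fun g : S →ₐ[R] P[X] => scalarMap A g t) ?_
      ext1 s
      exact (MvPolynomial.aeval _).commutes s
    have hX (i : Fin 2) : φ (MvPolynomial.X i) = Polynomial.X * Polynomial.C (MvPolynomial.X i) :=
      MvPolynomial.aeval_X _ i
    simp only [z, map_add, scalarMap_smul, hc, hX, smul_add, mul_smul, κ, constHom_apply]
  have key : scalarMap B φ (f.toFun' P z) =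
      (Polynomial.X : P[X]) • scalarMap B κ (f.toFun' P z) := by
    rw [f.scalarMap_toFun', f.scalarMap_toFun', hφ, hf, pow_one]
  have h1 (v : Fin 2 → S) (w : P ⊗[R] B) :
      (ℓ v).rTensor B ((Polynomial.X : P[X]) • scalarMap B κ w) = scalarMap B (ev v) w := by
    induction w with
    | zero => simp
    | add x y hx hy => simp only [smul_add, map_add, hx, hy]
    | tmul p b => simp [ℓ, κ, TensorProduct.smul_tmul']
  have h2 (v : Fin 2 → S) (w : P ⊗[R] B) : (ℓ v).rTensor B (scalarMap B φ w) =
      v 0 • (cf 0).rTensor B w + v 1 • (cf 1).rTensor B w := by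
    induction w with
    | zero => simp
    | add x y hx hy => simp only [smul_add, map_add, hx, hy]; abel
    | tmul p b =>
      simp only [scalarMap_tmul, LinearMap.rTensor_tmul, TensorProduct.smul_tmul',
        ← TensorProduct.add_tmul]
      congr 1
      induction p using MvPolynomial.induction_on' with
      | monomial d s =>
        have e1 : φ (MvPolynomial.monomial d s) = Polynomial.C (MvPolynomial.C s *
            (MvPolynomial.X 0 ^ d 0 * MvPolynomial.X 1 ^ d 1)) * Polynomial.X ^ (d 0 + d 1) := by
          refine (MvPolynomial.aeval_monomial _ d s).trans ?_
          rw [Finsupp.prod_fintype _ _ (fun _ => pow_zero _), Fin.prod_univ_two,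
            show algebraMap S P[X] s = Polynomial.C (MvPolynomial.C s) from rfl]
          simp only [map_mul, map_pow]
          ring
        have e2 : ℓ v (φ (MvPolynomial.monomial d s)) =
            if 1 = d 0 + d 1 then s * (v 0 ^ d 0 * v 1 ^ d 1) else 0 := by
          rw [e1]
          simp only [ℓ, LinearMap.comp_apply, LinearMap.restrictScalars_apply,
            Polynomial.lcoeff_apply, Polynomial.coeff_C_mul_X_pow]
          have hX (i : Fin 2) : ev v (MvPolynomial.X i) = v i := MvPolynomial.aeval_X _ i
          have hC : ev v (MvPolynomial.C s) = s := MvPolynomial.aeval_C _ s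
          split_ifs
          · simp only [AlgHom.toLinearMap_apply, map_mul, map_pow, hX, hC]
          · rw [map_zero]
        have e3 (i : Fin 2) : cf i (MvPolynomial.monomial d s) =
            if d = Finsupp.single i 1 then s else 0 := MvPolynomial.coeff_monomial _ _ _
        rw [e2, e3, e3]
        simp only [Finsupp.ext_iff, Fin.forall_fin_two]
        by_cases h0 : d 0 = 0
        · by_cases h1 : d 1 = 1
          · simp [h0, h1, mul_comm]
          · simp [h0, h1, Ne.symm h1]
        · by_cases h1 : d 0 = 1
          · by_cases h2 : d 1 = 0 <;> simp [h1, h2, mul_comm]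
          · have : 1 ≠ d 0 + d 1 := by omega
            simp [h0, h1, this]
      | add p q hp hq => simp only [smul_add, map_add, hp, hq]; abel
  have h3 (v : Fin 2 → S) : scalarMap A (ev v) z = v 0 • x + v 1 • y := by
    have (t : S ⊗[R] A) : scalarMap A (ev v) (scalarMap A c t) = t := by
      rw [scalarMap_scalarMap, show (ev v).comp c = AlgHom.id R S by ext; simp [ev, c], scalarMap_id]
    have hX (i : Fin 2) : ev v (MvPolynomial.X i) = v i := MvPolynomial.aeval_X _ i
    simp only [z, map_add, scalarMap_smul, this, hX]
  have h4 (v : Fin 2 → S) : f.toFun' S (v 0 • x + v 1 • y) =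
      v 0 • (cf 0).rTensor B (f.toFun' P z) + v 1 • (cf 1).rTensor B (f.toFun' P z) := by
    rw [← h3, ← f.scalarMap_toFun', ← h1, ← key, h2]
  have e0 := h4 ![1, 0]
  have e1 := h4 ![0, 1]
  have e2 := h4 ![1, 1]
  simp only [Matrix.cons_val_zero, Matrix.cons_val_one, _root_.one_smul, _root_.zero_smul, add_zero,
    zero_add] at e0 e1 e2
  rw [e0, e1, e2]

/-- Degree one makes every `f_S` linear over `S`, so it is determined by its values on the `1 ⊗ a`.
By naturality these come from the ground map, which is the homomorphism sought. -/
theorem PolynomialLaw.IsHomogeneousOfDegree.exists_algHom {f : A →ₚₗ[R] B}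
    (hf : f.IsHomogeneousOfDegree 1) (hm : f.IsMultiplicative) :
    ∃ φ : A →ₐ[R] B, f = φ.toLinearMap.toPolynomialLaw := by
  have hsmul (S : Type u) [CommRing S] [Algebra R S] (s : S) (x : S ⊗[R] A) :
      f.toFun' S (s • x) = s • f.toFun' S x := by rw [hf, pow_one]
  let L (S : Type u) [CommRing S] [Algebra R S] : S ⊗[R] A →ₗ[S] S ⊗[R] B :=
    { toFun := f.toFun' S
      map_add' := hf.toFun'_add
      map_smul' := hsmul S }
  let φ : A →ₐ[R] B := AlgHom.ofLinearMap
    ((TensorProduct.lid R B).toLinearMap ∘ₗ L R ∘ₗ (TensorProduct.lid R A).symm.toLinearMap)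
    (by
      change TensorProduct.lid R B (f.toFun' R 1) = 1
      rw [(hm R).2]
      exact map_one (Algebra.TensorProduct.lid R B))
    (fun a b => by
      change TensorProduct.lid R B (f.toFun' R (1 ⊗ₜ (a * b))) = _
      have := (hm R).1 (1 ⊗ₜ a) (1 ⊗ₜ b)
      rw [Algebra.TensorProduct.tmul_mul_tmul, one_mul] at this
      rw [this]
      exact map_mul (Algebra.TensorProduct.lid R B) _ _)
  refine ⟨φ, PolynomialLaw.ext_of_commRing fun S _ _ x => ?_⟩
  rw [AlgHom.toPolynomialLaw_toFun']
  change L S x = _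
  induction x with
  | zero => simp
  | add x y hx hy => simp only [map_add, hx, hy]
  | tmul s a =>
    have := f.one_tmul_ground_apply' (S := S) a
    rw [valueMap_tmul, show φ a = f.ground a from rfl]
    rw [show s ⊗ₜ[R] a = s • (1 ⊗ₜ a) by simp [TensorProduct.smul_tmul'], map_smul]
    change s • f.toFun' S _ = _
    rw [← this, TensorProduct.smul_tmul', smul_eq_mul, mul_one]

end DegreeOne

/-! ### Existence of closures -/

section Existence

open Polynomial

variable {R : Type u} [CommRing R] {A B C : Type u} [CommRing A] [Algebra R A]
  [CommRing B] [Algebra R B] [CommRing C] [Algebra R C]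

/-- The coordinates of an element of `M ⊗ C` for a basis of `M`. -/
def tensorCoord {ι M : Type*} [AddCommGroup M] [Module R M] (e : Module.Basis ι R M) (i : ι) :
    M ⊗[R] C →ₗ[R] C :=
  (TensorProduct.lid R C).toLinearMap ∘ₗ (e.coord i).rTensor C

/-- Together with `eq_zero_of_tensorCoord`, this turns the vanishing of an element of `S ⊗ B` after
applying `γ` into the condition that `γ` kills its coordinates in `B`. -/
theorem tensorCoord_valueMap {ι S : Type*} [CommRing S] [Algebra R S] (e : Module.Basis ι R S)
    (i : ι) (γ : B →ₐ[R] C) (x : S ⊗[R] B) :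
    tensorCoord e i (valueMap S γ x) = γ (tensorCoord e i x) := by
  induction x with
  | zero => simp
  | add x y hx hy => simp only [map_add, hx, hy]
  | tmul s b => simp [tensorCoord]

theorem eq_zero_of_tensorCoord {ι M : Type*} [AddCommGroup M] [Module R M]
    (e : Module.Basis ι R M) {x : M ⊗[R] C} (h : ∀ i, tensorCoord e i x = 0) : x = 0 := by
  classical
  refine (TensorProduct.equivFinsuppOfBasisLeft e).injective ?_
  ext i
  rw [map_zero, Finsupp.zero_apply, ← h i]
  clear h
  induction x with
  | zero => simp
  | add x y hx hy => simp only [map_add, Finsupp.add_apply, hx, hy]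
  | tmul s b => simp [tensorCoord]

variable (R A) in
/-- The coproduct of finitely many copies of an algebra. -/
theorem exists_algebra_coproduct (σ : Type) [Fintype σ] :
    ∃ (T : Type u) (_ : CommRing T) (_ : Algebra R T) (ι : σ → A →ₐ[R] T),
      (∀ (B : Type u) [CommRing B] [Algebra R B] (β : σ → A →ₐ[R] B),
        ∃ ψ : T →ₐ[R] B, ∀ s, ψ.comp (ι s) = β s) ∧
      (∀ (B : Type u) [CommRing B] [Algebra R B] (ψ ψ' : T →ₐ[R] B),
        (∀ s, ψ.comp (ι s) = ψ'.comp (ι s)) → ψ = ψ') := by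
  classical
  refine ⟨PiTensorProduct R fun _ : σ => A, inferInstance, inferInstance,
    fun s => PiTensorProduct.singleAlgHom (A := fun _ : σ => A) s, fun B _ _ β => ?_,
    fun B _ _ ψ ψ' h => ?_⟩
  · refine ⟨PiTensorProduct.liftAlgHom
      ((MultilinearMap.mkPiAlgebra R σ B).compLinearMap fun s => (β s).toLinearMap) ?_ ?_, ?_⟩
    · simp
    · simp [Finset.prod_mul_distrib]
    · intro s
      ext a
      have : ∏ i, β i (Pi.mulSingle (M := fun _ : σ => A) s a i) = β s a := by
        rw [Finset.prod_eq_single s (fun i _ hi => by rw [Pi.mulSingle_eq_of_ne hi, map_one])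
          (fun h => absurd (Finset.mem_univ s) h), Pi.mulSingle_eq_same]
      exact (PiTensorProduct.lift.tprod _).trans (by simpa using this)
  · exact PiTensorProduct.algHom_ext h

variable {σ : Type*} [Fintype σ] [Module.Finite R A] [Module.Projective R A]

/-- The remainder of the characteristic polynomial of `x` by `∏ i, (X - α i x)`. -/
def splitRemainder (α : σ → A →ₐ[R] C) (S : Type u) [CommRing S] [Algebra R S] (x : S ⊗[R] A) :
    (S ⊗[R] C)[X] :=
  (elemCharpoly S x).map (algebraMap S (S ⊗[R] C)) %ₘ
    ∏ i, (X - Polynomial.C (valueMap S (α i) x))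

theorem splitsCharpoly_iff_splitRemainder (α : σ → A →ₐ[R] C) : SplitsCharpoly α ↔
    ∀ (S : Type u) [CommRing S] [Algebra R S] (x : S ⊗[R] A), splitRemainder α S x = 0 := by
  rw [splitsCharpoly_iff]
  refine forall_congr' fun S => forall_congr' fun _ => forall_congr' fun _ => forall_congr' fun x =>
    (modByMonic_eq_zero_iff_dvd (monic_prod_of_monic _ _ fun i _ => monic_X_sub_C _)).symm

theorem map_splitRemainder_scalarMap (α : σ → A →ₐ[R] C) {S S' : Type u} [CommRing S]
    [Algebra R S] [CommRing S'] [Algebra R S'] (φ : S →ₐ[R] S') (x : S ⊗[R] A) :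
    (splitRemainder α S x).map (scalarMap C φ).toRingHom =
      splitRemainder α S' (scalarMap A φ x) := by
  rw [splitRemainder, map_modByMonic _ (monic_prod_of_monic _ _ fun i _ => monic_X_sub_C _),
    splitRemainder, ← map_elemCharpoly, Polynomial.map_prod, map_map, map_map]
  congr 2
  ext1 i
  simp [valueMap_scalarMap]

theorem map_splitRemainder_valueMap (α : σ → A →ₐ[R] B) (γ : B →ₐ[R] C) (S : Type u) [CommRing S]
    [Algebra R S] (x : S ⊗[R] A) :
    (splitRemainder α S x).map (valueMap S γ).toRingHom =
      splitRemainder (fun i => γ.comp (α i)) S x := by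
  rw [splitRemainder, map_modByMonic _ (monic_prod_of_monic _ _ fun i _ => monic_X_sub_C _),
    splitRemainder, Polynomial.map_prod, map_map]
  congr 2
  · ext s
    simp
  · ext1 i
    simp [valueMap_valueMap]

variable (R A) in
/-- There is an element of which all elements of base changes of `A` are specializations. -/
theorem exists_generic : ∃ (k : ℕ) (g : MvPolynomial (Fin k) R ⊗[R] A),
    ∀ (S : Type u) [CommRing S] [Algebra R S] (x : S ⊗[R] A),
      ∃ φ : MvPolynomial (Fin k) R →ₐ[R] S, scalarMap A φ g = x := by
  obtain ⟨k, b, l, h⟩ := exists_isDualBasis R A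
  refine ⟨k, ∑ i, MvPolynomial.X i ⊗ₜ b i, fun S _ _ x => ?_⟩
  refine ⟨MvPolynomial.aeval fun i =>
    TensorProduct.AlgebraTensorModule.rid R S S ((l i).baseChange S x), ?_⟩
  conv_rhs => rw [← h.baseChange S x]
  simp [TensorProduct.smul_tmul']

/-- Remainders commute with change of scalars, so every remainder is a specialization of the one at
`g`. -/
theorem splitsCharpoly_iff_generic {k : ℕ} {g : MvPolynomial (Fin k) R ⊗[R] A}
    (hg : ∀ (S : Type u) [CommRing S] [Algebra R S] (x : S ⊗[R] A),
      ∃ φ : MvPolynomial (Fin k) R →ₐ[R] S, scalarMap A φ g = x) (α : σ → A →ₐ[R] C) :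
    SplitsCharpoly α ↔ splitRemainder α _ g = 0 := by
  rw [splitsCharpoly_iff_splitRemainder]
  refine ⟨fun h => h _ g, fun h S _ _ x => ?_⟩
  obtain ⟨φ, rfl⟩ := hg S x
  rw [← map_splitRemainder_scalarMap, h, Polynomial.map_zero]

variable (R A) in
theorem exists_isClosureOf (σ : Type) [Fintype σ] :
    ∃ (C : Type u) (_ : CommRing C) (_ : Algebra R C) (α : σ → A →ₐ[R] C), IsClosureOf α := by
  obtain ⟨T, _, _, ι, hT, hT'⟩ := exists_algebra_coproduct R A σ
  obtain ⟨k, g, hg⟩ := exists_generic R A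
  let e := MvPolynomial.basisMonomials (Fin k) R
  let I : Ideal T := Ideal.span
    {t | ∃ i j, t = tensorCoord e i ((splitRemainder ι (MvPolynomial (Fin k) R) g).coeff j)}
  -- Applying `ψ` to the generic remainder gives the remainder for the composed family, so splitting
  -- means that `ψ` kills the generators of `I`.
  have key {B : Type u} [CommRing B] [Algebra R B] (ψ : T →ₐ[R] B) :
      SplitsCharpoly (fun s => ψ.comp (ι s)) ↔ ∀ t ∈ I, ψ t = 0 := by
    rw [splitsCharpoly_iff_generic hg, ← map_splitRemainder_valueMap]
    constructor
    · intro h t ht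
      refine (Ideal.span_le (I := RingHom.ker ψ)).2 ?_ ht
      rintro _ ⟨i, j, rfl⟩
      have := congrArg (fun p => tensorCoord e i (coeff p j)) h
      simp only [coeff_map, coeff_zero, map_zero] at this
      exact (tensorCoord_valueMap e i ψ _).symm.trans this
    · intro h
      ext j
      rw [coeff_map, coeff_zero]
      refine eq_zero_of_tensorCoord e fun i => ?_
      exact (tensorCoord_valueMap e i ψ _).trans (h _ (Ideal.subset_span ⟨i, j, rfl⟩))
  refine ⟨T ⧸ I, inferInstance, inferInstance, fun s => (Ideal.Quotient.mkₐ R I).comp (ι s), ?_, ?_⟩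
  · exact (key _).2 fun t ht => Ideal.Quotient.eq_zero_iff_mem.2 ht
  · intro B _ _ β hβ
    obtain ⟨ψ, hψ⟩ := hT B β
    obtain rfl : (fun s => ψ.comp (ι s)) = β := funext hψ
    refine ⟨Ideal.Quotient.liftₐ I ψ ((key ψ).1 hβ), fun s => ?_, fun φ hφ => ?_⟩
    · ext a
      exact Ideal.Quotient.lift_mk I _ ((key ψ).1 hβ)
    · refine Ideal.Quotient.algHom_ext _ (hT' _ _ _ fun s => ?_)
      rw [AlgHom.comp_assoc, hφ]
      ext a
      exact (Ideal.Quotient.lift_mk I _ ((key ψ).1 hβ)).symm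

end Existence

/-! ### Comparison of the universal properties -/

section Main

variable {R : Type u} [CommRing R] {A B C : Type u} [CommRing A] [Algebra R A]
  [CommRing B] [Algebra R B] [CommRing C] [Algebra R C]
  {n m : ℕ}

theorem homsAndLaw_push_eq_iff {α : Fin m → A →ₐ[R] C} {lam : A →ₚₗ[R] C} {φ : C →ₐ[R] B}
    {β : Fin m → A →ₐ[R] B} {μ : A →ₚₗ[R] B} :
    (∀ i, (homsAndLaw α lam i).push φ = homsAndLaw β μ i) ↔
      (∀ i, φ.comp (α i) = β i) ∧ lam.push φ = μ := by
  rw [Fin.forall_fin_succ', and_congr]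
  · refine forall_congr' fun i => ?_
    simp only [homsAndLaw, Fin.snoc_castSucc, AlgHom.push_toPolynomialLaw]
    exact ⟨AlgHom.toPolynomialLaw_injective, fun h => by rw [h]⟩
  · simp only [homsAndLaw, Fin.snoc_last]

variable [Module.Finite R A] [Module.Projective R A]

theorem FactorsNorm.isNormFactorization
    (hA : ∀ p : PrimeSpectrum R, Module.rankAtStalk A p = n) (hmn : m ≤ n)
    {β : Fin m → A →ₐ[R] B} {μ : A →ₚₗ[R] B} (h : FactorsNorm (homsAndLaw β μ)) :
    IsNormFactorization (onesAndRest n m) (homsAndLaw β μ) where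
  homogeneous i := by
    refine Fin.lastCases ?_ (fun i => ?_) i
    · simpa only [homsAndLaw, onesAndRest, Fin.snoc_last] using h.isHomogeneous hA hmn
    · simpa only [homsAndLaw, onesAndRest, Fin.snoc_castSucc] using
        (β i).toPolynomialLaw_isHomogeneous
  multiplicative i := by
    refine Fin.lastCases ?_ (fun i => ?_) i
    · simpa only [homsAndLaw, Fin.snoc_last] using h.isMultiplicative
    · simpa only [homsAndLaw, Fin.snoc_castSucc] using (β i).toPolynomialLaw_isMultiplicative
  factorsNorm := h

theorem IsNormFactorization.exists_homsAndLaw {δ : Fin (m + 1) → A →ₚₗ[R] B}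
    (h : IsNormFactorization (onesAndRest n m) δ) :
    ∃ (β : Fin m → A →ₐ[R] B) (μ : A →ₚₗ[R] B), δ = homsAndLaw β μ := by
  have (i : Fin m) : ∃ φ : A →ₐ[R] B, δ i.castSucc = φ.toLinearMap.toPolynomialLaw := by
    have h1 := h.homogeneous i.castSucc
    simp only [onesAndRest, Fin.snoc_castSucc] at h1
    exact h1.exists_algHom (h.multiplicative _)
  choose β hβ using this
  refine ⟨β, δ (Fin.last m), funext fun i => ?_⟩
  refine Fin.lastCases ?_ (fun i => ?_) i
  · simp only [homsAndLaw, Fin.snoc_last]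
  · simp only [homsAndLaw, Fin.snoc_castSucc, hβ]

/-- A closure is universal for completions of homomorphisms to a factorization of the norm. -/
theorem IsClosureOf.existsUnique_push {α : Fin m → A →ₐ[R] C} (hα : IsClosureOf α)
    {lam : A →ₚₗ[R] C} (hlam : FactorsNorm (homsAndLaw α lam)) {β : Fin m → A →ₐ[R] B}
    {μ : A →ₚₗ[R] B} (h : FactorsNorm (homsAndLaw β μ)) :
    ∃! φ : C →ₐ[R] B, (∀ i, φ.comp (α i) = β i) ∧ lam.push φ = μ := by
  obtain ⟨φ, hφ, huniq⟩ := hα.universal B β h.splitsCharpoly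
  refine ⟨φ, ⟨hφ, ?_⟩, fun ψ hψ => huniq ψ hψ.1⟩
  -- The pushed law and `μ` both complete `β` to a factorization, so they agree by uniqueness of the
  -- completing law.
  have h1 := hlam.push φ
  rw [homsAndLaw_push, show (fun i => φ.comp (α i)) = β from funext hφ] at h1
  exact h1.law_unique h

theorem IsFerrandAlgebra.existsUnique_algEquiv {ι : Type*} [Fintype ι] {d : ι → ℕ}
    {γ : ι → A →ₚₗ[R] C} {δ : ι → A →ₚₗ[R] B} (hγ : IsFerrandAlgebra d γ)
    (hδ : IsFerrandAlgebra d δ) : ∃! e : C ≃ₐ[R] B, ∀ i, (γ i).push (e : C →ₐ[R] B) = δ i := by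
  obtain ⟨φ, hφ, huniq⟩ := hγ.universal B δ hδ.isNormFactorization
  obtain ⟨ψ, hψ, -⟩ := hδ.universal C γ hγ.isNormFactorization
  have h1 : φ.comp ψ = AlgHom.id R B :=
    (hδ.universal B δ hδ.isNormFactorization).unique
      (fun i => by rw [← PolynomialLaw.push_comp, hψ, hφ]) fun i => PolynomialLaw.push_id _
  have h2 : ψ.comp φ = AlgHom.id R C :=
    (hγ.universal C γ hγ.isNormFactorization).unique
      (fun i => by rw [← PolynomialLaw.push_comp, hφ, hψ]) fun i => PolynomialLaw.push_id _
  refine ⟨AlgEquiv.ofAlgHom φ ψ h1 h2, hφ, fun e he => ?_⟩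
  ext x
  exact DFunLike.congr_fun (huniq (e : C →ₐ[R] B) he) x

end Main

end

theorem mainTheorem6 {R A : Type u} [CommRing R] [CommRing A] [Algebra R A]
    [Module.Finite R A] [Module.Projective R A] (n : ℕ)
    (hA : ∀ p : PrimeSpectrum R, Module.rankAtStalk A p = n)
    (m : ℕ) (hm : 1 ≤ m) (hmn : m ≤ n) :
    -- the `m`-closure exists
    (∃ (C : Type u) (_ : CommRing C) (_ : Algebra R C) (α : Fin m → A →ₐ[R] C),
      IsClosureOf α) ∧
    -- a law of degree `n - m` completing `m` homomorphisms to a factorization is multiplicative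
    (∀ (B : Type u) [CommRing B] [Algebra R B] (β : Fin m → A →ₐ[R] B) (μ : A →ₚₗ[R] B),
      μ.IsHomogeneousOfDegree (n - m) → FactorsNorm (homsAndLaw β μ) → μ.IsMultiplicative) ∧
    -- every `m`-closure is Ferrand's algebra
    (∀ (C : Type u) [CommRing C] [Algebra R C] (α : Fin m → A →ₐ[R] C), IsClosureOf α →
      ∃ lam : A →ₚₗ[R] C,
        lam.IsHomogeneousOfDegree (n - m) ∧
        lam.IsMultiplicative ∧
        FactorsNorm (homsAndLaw α lam) ∧
        (∀ lam' : A →ₚₗ[R] C, FactorsNorm (homsAndLaw α lam') → lam' = lam) ∧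
        IsFerrandAlgebra (onesAndRest n m) (homsAndLaw α lam) ∧
        (∀ (B : Type u) [CommRing B] [Algebra R B] (β : Fin m → A →ₐ[R] B) (μ : A →ₚₗ[R] B),
          μ.IsHomogeneousOfDegree (n - m) → FactorsNorm (homsAndLaw β μ) →
          ∃! φ : C →ₐ[R] B, (∀ i, φ.comp (α i) = β i) ∧ lam.push φ = μ) ∧
        (∀ (D : Type u) [CommRing D] [Algebra R D] (δ : Fin (m + 1) → A →ₚₗ[R] D),
          IsFerrandAlgebra (onesAndRest n m) δ →
          ∃! e : C ≃ₐ[R] D, ∀ i, (homsAndLaw α lam i).push (e : C →ₐ[R] D) = δ i)) := by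
  refine ⟨exists_isClosureOf R A (Fin m), fun B _ _ β μ _ h => h.isMultiplicative,
    fun C _ _ α hα => ?_⟩
  have hlam := hα.splits.factorsNorm
  have hF : IsFerrandAlgebra (onesAndRest n m) (homsAndLaw α (residualLaw α)) := by
    refine ⟨hlam.isNormFactorization hA hmn, fun B _ _ β hβ => ?_⟩
    -- The first `m` laws have degree one, so Ferrand's data become homomorphisms with one further
    -- law and the universality of the closure applies.
    obtain ⟨β, μ, rfl⟩ := hβ.exists_homsAndLaw
    simpa only [homsAndLaw_push_eq_iff] using hα.existsUnique_push hlam hβ.factorsNorm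
  exact ⟨residualLaw α, hlam.isHomogeneous hA hmn, hlam.isMultiplicative, hlam,
    fun lam' h' => h'.law_unique hlam, hF,
    fun B _ _ β μ _ h => hα.existsUnique_push hlam h,
    fun D _ _ δ hδ => hF.existsUnique_algEquiv hδ⟩
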